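/- For $n \ge 0$ let $S_n(132)$ be the set of permutations $\sigma=\sigma_1\cdots\sigma_n$ of $\{1,\dots,n\}$ that avoid the pattern $132$, i.e. for which there are no $a<b<c$ with $\sigma_a<\sigma_c<\sigma_b$. For a permutation $\tau$ of length $k$, let $f(\sigma,\tau)$ be the number of occurrences of $\tau$ in $\sigma$, i.e. of index sequences $i_1<\dots<i_k$ such that $\sigma_{i_s}<\sigma_{i_t}$ if and only if $\tau_s<\tau_t$ for all $s,t$, and let $$A_n(\tau)=\sum_{\sigma\in S_n(132)} f(\sigma,\tau)$$ (with the convention $A_n(\tau)=1$ if $k=0$). For $\sigma\in S_n(132)$ let $T(\sigma)$ be the unique binary tree with $n$ vertices (each child being a left or a right child) with the following property: if the $i$-th vertex visited in pre-order (root, left subtree, right subtree) is labelled $n+1-i$ for each $i$, then reading the labels in in-order (left subtree, root, right subtree) gives $\sigma_1\cdots\sigma_n$. The spines of a binary tree are the connected components that remain when all edges joining a left child to its parent are deleted, and the spine structure of the tree is the sequence $\langle a_1,\dots,a_s\rangle$ of the numbers of vertices of its spines, listed in descending order. For two spine structures with the same sum, $\langle b_1,\dots,b_t\rangle\le\langle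 a_1,\dots,a_s\rangle$ in refinement order means that $\langle a_1,\dots,a_s\rangle$ is obtained from $\langle b_1,\dots,b_t\rangle$ by merging subsets of parts, i.e. the parts $b_1,\dots,b_t$ can be partitioned into $s$ nonempty blocks whose sums are $a_1,\dots,a_s$. **Theorem.** Let $\tau,\mu\in S_k(132)$. If the spine structure of $T(\tau)$ is less than or equal to the spine structure of $T(\mu)$ in refinement order, then $A_n(\tau)\le A_n(\mu)$ for all $n$. -/

import Mathlib

namespace Pop132

/-! ### Permutation patterns -/

/-- The occurrences of the pattern `τ` in `σ`: increasing choices of positions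
`e 0 < e 1 < ⋯ < e (k - 1)` such that the entries of `σ` at these positions are in the same
relative order as the entries of `τ`. -/
def Occurrence {n k : ℕ} (σ : Equiv.Perm (Fin n)) (τ : Equiv.Perm (Fin k)) : Type :=
  {e : Fin k ↪o Fin n // ∀ i j : Fin k, σ (e i) < σ (e j) ↔ τ i < τ j}

/-- The number `f(σ, τ)` of copies of `τ` in `σ`. -/
noncomputable def numCopies {n k : ℕ} (σ : Equiv.Perm (Fin n)) (τ : Equiv.Perm (Fin k)) : ℕ :=
  Nat.card (Occurrence σ τ)

/-- The pattern `132`; in zero-based notation it maps `0, 1, 2` to `0, 2, 1`. -/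
def pattern132 : Equiv.Perm (Fin 3) := Equiv.swap 1 2

/-- `σ` does not contain the pattern `132`. -/
def Avoids132 {n : ℕ} (σ : Equiv.Perm (Fin n)) : Prop :=
  IsEmpty (Occurrence σ pattern132)

open Classical in
/-- The set `S_n(132)` of all `132`-avoiding permutations of length `n`. -/
noncomputable def S132 (n : ℕ) : Finset (Equiv.Perm (Fin n)) :=
  Finset.univ.filter fun σ => Avoids132 σ

/-- The popularity `A_n(τ)`: the total number of copies of `τ` in all elements of `S_n(132)`.
For the pattern of length `0` it is `1` by convention. -/
noncomputable def popularity (n : ℕ) {k : ℕ} (τ : Equiv.Perm (Fin k)) : ℕ :=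
  if k = 0 then 1 else ∑ σ ∈ S132 n, numCopies σ τ

/-! ### The binary tree of a `132`-avoiding permutation

Binary trees with `n` (unlabelled) vertices are the elements `T : BinaryTree Unit` with
`T.numNodes = n`; the constructor `BinaryTree.nil` is the empty tree. -/

/-- Label the vertices of a binary tree in pre-order (root, left subtree, right subtree) by
`c, c - 1, c - 2, …`. -/
def preorderLabel : ℕ → BinaryTree Unit → BinaryTree ℕ
  | _, .nil => .nil
  | c, .node _ l r =>
      .node c (preorderLabel (c - 1) l) (preorderLabel (c - 1 - l.numNodes) r)

/-- The labels of a binary tree in in-order (left subtree, root, right subtree). -/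
def inorder {α : Type} : BinaryTree α → List α
  | .nil => []
  | .node a l r => inorder l ++ a :: inorder r

/-- The word of a binary tree `T` with `n` vertices: the `i`-th vertex in pre-order gets the label
`n + 1 - i`, and the labels are read in in-order. -/
def treeWord (T : BinaryTree Unit) : List ℕ := inorder (preorderLabel T.numNodes T)

/-- The one-line notation `σ_1 σ_2 … σ_n`, with entries in `{1, …, n}`. -/
def oneLine {n : ℕ} (σ : Equiv.Perm (Fin n)) : List ℕ := List.ofFn fun i => (σ i : ℕ) + 1

theorem length_inorder_preorderLabel (T : BinaryTree Unit) :
    ∀ c, (inorder (preorderLabel c T)).length = T.numNodes := by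
  induction T with
  | nil => intro c; rfl
  | node a l r hl hr =>
    intro c
    simp only [preorderLabel, inorder, List.length_append, List.length_cons, hl, hr,
      BinaryTree.numNodes]
    omega

theorem le_of_mem_inorder_preorderLabel (T : BinaryTree Unit) :
    ∀ c x, x ∈ inorder (preorderLabel c T) → x ≤ c := by
  induction T with
  | nil => intro c x hx; simp [preorderLabel, inorder] at hx
  | node a l r hl hr =>
    intro c x hx
    simp only [preorderLabel, inorder, List.mem_append, List.mem_cons] at hx
    rcases hx with h | h | h
    · have := hl _ _ h; omega
    · omega
    · have := hr _ _ h; omega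

theorem inorder_preorderLabel_injective (T : BinaryTree Unit) :
    ∀ (U : BinaryTree Unit) (c : ℕ), T.numNodes ≤ c →
      inorder (preorderLabel c T) = inorder (preorderLabel c U) → T = U := by
  induction T with
  | nil =>
    intro U c _ h
    cases U with
    | nil => rfl
    | node a l r => simp [preorderLabel, inorder] at h
  | node a l r hl hr =>
    intro U c hc h
    cases U with
    | nil => simp [preorderLabel, inorder] at h
    | node a' l' r' =>
      simp only [BinaryTree.numNodes] at hc
      simp only [preorderLabel, inorder] at h
      have n1 : c ∉ inorder (preorderLabel (c - 1) l) := fun hx => by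
        have := le_of_mem_inorder_preorderLabel _ _ _ hx; omega
      have n2 : c ∉ inorder (preorderLabel (c - 1) l') := fun hx => by
        have := le_of_mem_inorder_preorderLabel _ _ _ hx; omega
      have hsplit : inorder (preorderLabel (c - 1) l) = inorder (preorderLabel (c - 1) l') ∧
          inorder (preorderLabel (c - 1 - l.numNodes) r) =
            inorder (preorderLabel (c - 1 - l'.numNodes) r') := by
        rw [List.append_eq_append_iff] at h
        rcases h with ⟨as, h1, h2⟩ | ⟨as, h1, h2⟩
        · cases as with
          | nil => simp at h1 h2; exact ⟨h1.symm, h2⟩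
          | cons x as =>
            simp at h2
            exact absurd (by rw [h1, h2.1]; simp) n2
        · cases as with
          | nil => simp at h1 h2; exact ⟨h1, h2.symm⟩
          | cons x as =>
            simp at h2
            exact absurd (by rw [h1, h2.1]; simp) n1
      obtain ⟨e1, e2⟩ := hsplit
      have hl' := hl l' (c - 1) (by omega) e1
      subst hl'
      have hr' := hr r' _ (by omega) e2
      subst hr'
      rfl

theorem exists_tree_of_word (N : ℕ) :
    ∀ (w : List ℕ) (s : ℕ), w.length = N → w.Nodup → (∀ x ∈ w, s < x ∧ x ≤ s + w.length) →
      (∀ a b c, [a, b, c].Sublist w → ¬ (a < c ∧ c < b)) →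
      ∃ T : BinaryTree Unit, T.numNodes = w.length ∧
        inorder (preorderLabel (s + w.length) T) = w := by
  induction N using Nat.strong_induction_on with
  | _ N ih =>
  intro w s hN hnd hb hav
  by_cases hw : w = []
  · subst hw; exact ⟨.nil, rfl, rfl⟩
  have hpos : 0 < w.length := List.length_pos_iff.mpr hw
  have hmem : s + w.length ∈ w := by
    have hsub : w.toFinset ⊆ Finset.Ioc s (s + w.length) := by
      intro x hx
      rw [List.mem_toFinset] at hx
      exact Finset.mem_Ioc.mpr (hb x hx)
    have heq := Finset.eq_of_subset_of_card_le hsub (by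
      rw [List.toFinset_card_of_nodup hnd, Nat.card_Ioc]; omega)
    have : s + w.length ∈ Finset.Ioc s (s + w.length) := Finset.mem_Ioc.mpr ⟨by omega, le_rfl⟩
    rw [← heq, List.mem_toFinset] at this
    exact this
  obtain ⟨l, r, hlr⟩ := List.append_of_mem hmem
  generalize hm : s + w.length = m at *
  subst hlr
  simp only [List.length_append, List.length_cons] at hm hN
  have hnd' := List.nodup_append.mp hnd
  obtain ⟨ndl, ndr', hdisj⟩ := hnd'
  obtain ⟨hmr, ndr⟩ := List.nodup_cons.mp ndr'
  have hltl : ∀ x ∈ l, s < x ∧ x < m := fun x hx => by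
    have h1 := hb x (by simp [hx])
    have h2 := hdisj x hx m (by simp)
    omega
  have hltr : ∀ x ∈ r, s < x ∧ x < m := fun x hx => by
    have h1 := hb x (by simp [hx])
    have h2 : x ≠ m := fun h => hmr (h ▸ hx)
    omega
  have hgt : ∀ x ∈ l, ∀ y ∈ r, y < x := by
    intro x hx y hy
    by_contra hcon
    have hne := hdisj x hx y (by simp [hy])
    refine hav x m y ?_ ⟨by omega, (hltr y hy).2⟩
    exact (List.singleton_sublist.mpr hx).append ((List.singleton_sublist.mpr hy).cons_cons m)
  have hr2 : ∀ x ∈ r, s < x ∧ x ≤ s + r.length := by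
    intro x hx
    refine ⟨(hltr x hx).1, ?_⟩
    have hsub : l.toFinset ⊆ Finset.Ioo x m := by
      intro y hy
      rw [List.mem_toFinset] at hy
      exact Finset.mem_Ioo.mpr ⟨hgt y hy x hx, (hltl y hy).2⟩
    have hc := Finset.card_le_card hsub
    rw [List.toFinset_card_of_nodup ndl, Nat.card_Ioo] at hc
    have := (hltr x hx).2
    omega
  have hl2 : ∀ x ∈ l, s + r.length < x ∧ x ≤ s + r.length + l.length := by
    intro x hx
    refine ⟨?_, by have := (hltl x hx).2; omega⟩
    have hsub : r.toFinset ⊆ Finset.Ioo s x := by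
      intro y hy
      rw [List.mem_toFinset] at hy
      exact Finset.mem_Ioo.mpr ⟨(hltr y hy).1, hgt x hx y hy⟩
    have hc := Finset.card_le_card hsub
    rw [List.toFinset_card_of_nodup ndr, Nat.card_Ioo] at hc
    have := (hltl x hx).1
    omega
  obtain ⟨L, hL1, hL2⟩ := ih l.length (by omega) l (s + r.length) rfl ndl hl2
    (fun a b c h => hav a b c (h.trans (List.sublist_append_left _ _)))
  obtain ⟨R, hR1, hR2⟩ := ih r.length (by omega) r s rfl ndr hr2
    (fun a b c h => hav a b c
      ((h.trans (List.sublist_cons_self _ _)).trans (List.sublist_append_right _ _)))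
  refine ⟨.node () L R, ?_, ?_⟩
  · simp only [BinaryTree.numNodes, hL1, hR1, List.length_append, List.length_cons]; omega
  · simp only [preorderLabel, inorder]
    rw [show m - 1 = s + r.length + l.length by omega, hL2,
      show s + r.length + l.length - L.numNodes = s + r.length by omega, hR2]

/-- Every `132`-avoiding permutation is the word of exactly one binary tree. -/
theorem existsUnique_tree {n : ℕ} (σ : Equiv.Perm (Fin n)) (hσ : Avoids132 σ) :
    ∃! T : BinaryTree Unit, treeWord T = oneLine σ := by
  have hlen : (oneLine σ).length = n := by simp [oneLine]
  obtain ⟨T, hT1, hT2⟩ := exists_tree_of_word n (oneLine σ) 0 hlen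
    (List.nodup_ofFn.mpr fun i j h => σ.injective (Fin.ext (by simpa using h)))
    (by
      intro x hx
      rw [hlen]
      obtain ⟨i, rfl⟩ := (List.mem_ofFn' _ _).mp hx
      have := (σ i).isLt
      constructor <;> simp only <;> omega)
    (by
      intro a b c hsub hlt
      obtain ⟨f, hf⟩ := List.sublist_iff_exists_fin_orderEmbedding_get_eq.mp hsub
      let e : Fin 3 ↪o Fin n := f.trans (Fin.castOrderIso hlen).toOrderEmbedding
      have he : ∀ i : Fin 3, ([a, b, c] : List ℕ).get i = (σ (e i) : ℕ) + 1 := by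
        intro i
        have := hf i
        simp only [oneLine, List.get_eq_getElem, List.getElem_ofFn] at this
        exact this
      have h0 : a = (σ (e 0) : ℕ) + 1 := he 0
      have h1 : b = (σ (e 1) : ℕ) + 1 := he 1
      have h2 : c = (σ (e 2) : ℕ) + 1 := he 2
      refine hσ.elim ⟨e, ?_⟩
      have p0 : pattern132 0 = 0 := by decide
      have p1 : pattern132 1 = 2 := by decide
      have p2 : pattern132 2 = 1 := by decide
      intro i j
      fin_cases i <;> fin_cases j <;>
        simp only [Fin.zero_eta, Fin.mk_one, Fin.reduceFinMk, p0, p1, p2, Fin.lt_def] <;>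
        simp <;> omega)
  refine ⟨T, ?_, ?_⟩
  · simp only [treeWord, hT1]; simpa using hT2
  · intro U hU
    have hn : U.numNodes = n := by
      rw [← length_inorder_preorderLabel U U.numNodes, ← hlen]
      exact congrArg List.length hU
    refine inorder_preorderLabel_injective U T n hn.le ?_
    have h3 : inorder (preorderLabel n U) = oneLine σ := by rw [← hU, treeWord, hn]
    rw [h3, ← hT2, hlen, Nat.zero_add]

/-- The binary tree `T(σ)` of a `132`-avoiding permutation `σ`: the unique binary tree whose word
is `σ`. -/
noncomputable def tree {n : ℕ} (σ : Equiv.Perm (Fin n)) (hσ : Avoids132 σ) : BinaryTree Unit :=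
  (existsUnique_tree σ hσ).choose

theorem treeWord_tree {n : ℕ} (σ : Equiv.Perm (Fin n)) (hσ : Avoids132 σ) :
    treeWord (tree σ hσ) = oneLine σ :=
  (existsUnique_tree σ hσ).choose_spec.1

/-! ### Spines -/

/-- The spines of a binary tree, that is, the connected components that remain after deleting all
edges from a vertex to its left child. Each spine is listed as its vertices from top to bottom, and
the first spine is the one that contains the root. Thus a root with right subtree `r` is added to
the component of the root of `r`, and the spines of the left subtree are left unchanged. -/
def spines {α : Type} : BinaryTree α → List (List α)
  | .nil => []
  | .node a l r =>
      match spines r with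
      | [] => [a] :: spines l
      | s :: ss => (a :: s) :: (spines l ++ ss)

/-- The spine structure of a binary tree: the numbers of vertices of its spines, in descending
order. -/
def spineStructure {α : Type} (T : BinaryTree α) : List ℕ :=
  ((spines T).map List.length).insertionSort (· ≥ ·)

/-- In the tree, the vertex labelled `c` is the right child of the vertex labelled `p`. -/
inductive IsRightChild {α : Type} : BinaryTree α → α → α → Prop
  | root (p c : α) (l l' r' : BinaryTree α) : IsRightChild (.node p l (.node c l' r')) p c
  | left {p c : α} (a : α) {l : BinaryTree α} (r : BinaryTree α) :
      IsRightChild l p c → IsRightChild (.node a l r) p c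
  | right {p c : α} (a : α) (l : BinaryTree α) {r : BinaryTree α} :
      IsRightChild r p c → IsRightChild (.node a l r) p c

/-- The spines together contain every vertex exactly once. -/
theorem flatten_spines_perm {α : Type} (T : BinaryTree α) :
    (spines T).flatten.Perm (inorder T) := by
  induction T with
  | nil => simp [spines, inorder]
  | node a l r hl hr =>
    simp only [spines, inorder]
    rcases h : spines r with _ | ⟨s, ss⟩
    · rw [h] at hr
      have hr' : inorder r = [] := by simpa using hr
      simp only [List.flatten_cons, hr', List.singleton_append]
      exact (hl.cons a).trans (List.perm_append_singleton a _).symm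
    · rw [h] at hr
      simp only [List.flatten_cons, List.flatten_append, List.cons_append] at hr ⊢
      refine List.Perm.trans ?_ List.perm_middle.symm
      refine List.Perm.cons a ?_
      rw [← List.append_assoc]
      refine (List.perm_append_comm.append_right _).trans ?_
      rw [List.append_assoc]
      exact hl.append hr

theorem spines_node_head {α : Type} (a : α) (l r : BinaryTree α) :
    ∃ s ss, spines (.node a l r) = (a :: s) :: ss := by
  simp only [spines]
  rcases spines r with _ | ⟨s, ss⟩ <;> simp

/-- Consecutive vertices of a spine are joined by an edge to a right child. -/
theorem isChain_of_mem_spines {α : Type} (T : BinaryTree α) :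
    ∀ s ∈ spines T, s.IsChain (IsRightChild T) := by
  induction T with
  | nil => simp [spines]
  | node a l r hl hr =>
    intro s hs
    have hl' : ∀ s ∈ spines l, s.IsChain (IsRightChild (.node a l r)) := fun s h =>
      (hl s h).imp fun _ _ h => .left a r h
    have hr' : ∀ s ∈ spines r, s.IsChain (IsRightChild (.node a l r)) := fun s h =>
      (hr s h).imp fun _ _ h => .right a l h
    cases r with
    | nil =>
      simp only [spines, List.mem_cons] at hs
      rcases hs with rfl | hs
      · simp
      · exact hl' s hs
    | node b l' r' =>
      obtain ⟨t, ts, ht⟩ := spines_node_head b l' r'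
      rw [spines, ht] at hs
      rw [ht] at hr'
      simp only [List.mem_cons, List.mem_append] at hs
      rcases hs with rfl | hs | hs
      · exact List.IsChain.cons_cons (.root a b l l' r') (hr' _ (by simp))
      · exact hl' s hs
      · exact hr' s (by simp [hs])

/-- A vertex and its right child lie on the same spine. -/
theorem exists_spine_of_isRightChild {α : Type} {T : BinaryTree α} {p c : α}
    (h : IsRightChild T p c) : ∃ s ∈ spines T, p ∈ s ∧ c ∈ s := by
  induction h with
  | root p c l l' r' =>
    obtain ⟨t, ts, ht⟩ := spines_node_head c l' r'
    exact ⟨p :: c :: t, by rw [spines, ht]; simp, by simp, by simp⟩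
  | @left p c a l r _ ih =>
    obtain ⟨s, hs, hp, hc⟩ := ih
    refine ⟨s, ?_, hp, hc⟩
    simp only [spines]
    rcases spines r with _ | ⟨t, ts⟩ <;> simp [hs]
  | @right p c a l r _ ih =>
    obtain ⟨s, hs, hp, hc⟩ := ih
    simp only [spines]
    rcases hr : spines r with _ | ⟨t, ts⟩
    · simp [hr] at hs
    · rw [hr, List.mem_cons] at hs
      rcases hs with rfl | hs
      · exact ⟨a :: s, by simp, by simp [hp], by simp [hc]⟩
      · exact ⟨s, by simp [hs], hp, hc⟩

/-- The refinement order `b ≤ a`: the parts of `a` are obtained from the parts of `b` by merging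
subsets of parts. That is, the parts of `b` can be distributed into nonempty blocks whose sums are
the parts of `a`. -/
def RefinementLE (b a : List ℕ) : Prop :=
  ∃ P : List (List ℕ), [] ∉ P ∧ P.flatten.Perm b ∧ (P.map List.sum).Perm a

end Pop132

/-! The popularity of `τ` depends only on the spine structure of its tree, through a product over
the spines; the theorem then reduces to one inequality about two spines.

Choosing entries of `σ` amounts to choosing vertices of T(σ), and the chosen subword is the word of
an induced tree. If the tree has subtrees L and R, dropping the root grafts the tree induced in R
onto the end of the root spine of the tree induced in L; keeping the root makes the two its
subtrees. Hence, for k > 0, A_n(τ) is the coefficient of X^n in F_P with P = T(τ), where F_P counts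
the copies of P among the induced trees of all binary trees (`numCopies_eq_count`,
`sum_numCopies_eq_coeff`).

Splitting at the root gives F_P = [P = nil] + X (∑ F_Q F_S + F_L F_R), where the sum is over `graft
Q S = P` and the last term appears only if P has a root with subtrees L and R. A split cuts only the
root spine of P; every other spine passes intact to one factor. With C the Catalan series, the
recurrence is therefore solved by F_P = C ∏ s_a over the spine lengths a, where s_0 = 1 and s_{m+1}
= X C (∑_{i+j=m+1} s_i s_j + s_m) (`occurrenceSeries_eq_prod`).

Finally s_a s_b ≤ s_{a+b} coefficientwise, by induction on a (`spineSeries_mul_le`), so merging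
parts cannot decrease F_P. -/

namespace Pop132

/-! ### Words represented by a binary tree -/

/-- The list `w` is order-isomorphic to the word of the binary tree. -/
def Represents : BinaryTree Unit → List ℕ → Prop
  | .nil, w => w = []
  | .node _ L R, w => ∃ l a r, w = l ++ a :: r ∧ Represents L l ∧ Represents R r ∧
      (∀ x ∈ l, x < a) ∧ (∀ y ∈ r, y < a) ∧ ∀ x ∈ l, ∀ y ∈ r, y < x

theorem Represents.length_eq {P : BinaryTree Unit} :
    ∀ {w}, Represents P w → w.length = P.numNodes := by
  induction P with
  | nil => rintro w rfl; rfl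
  | node u L R hL hR =>
    rintro w ⟨l, a, r, rfl, h1, h2, -⟩
    simp only [List.length_append, List.length_cons, hL h1, hR h2, BinaryTree.numNodes]
    omega

theorem Represents.nodup {P : BinaryTree Unit} : ∀ {w}, Represents P w → w.Nodup := by
  induction P with
  | nil => rintro w rfl; simp
  | node u L R hL hR =>
    rintro w ⟨l, a, r, rfl, h1, h2, h3, h4, h5⟩
    refine List.nodup_append.mpr ⟨hL h1, List.nodup_cons.mpr ⟨fun h => (h4 a h).false, hR h2⟩, ?_⟩
    intro x hx y hy
    rcases List.mem_cons.mp hy with rfl | hy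
    · exact (h3 x hx).ne
    · exact (h5 x hx y hy).ne'

theorem append_cons_inj_of_max {l r l' r' : List ℕ} {a a' : ℕ}
    (h : l ++ a :: r = l' ++ a' :: r') (hl : ∀ x ∈ l, x < a) (hr : ∀ x ∈ r, x < a)
    (hl' : ∀ x ∈ l', x < a') (hr' : ∀ x ∈ r', x < a') : l = l' ∧ a = a' ∧ r = r' := by
  rw [List.append_eq_append_iff] at h
  rcases h with ⟨as, h1, h2⟩ | ⟨as, h1, h2⟩
  · cases as with
    | nil => simp at h1 h2; exact ⟨h1.symm, h2⟩
    | cons x as =>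
      simp only [List.cons_append, List.cons.injEq] at h2
      obtain ⟨rfl, rfl⟩ := h2
      have e1 := hl' a (by simp [h1])
      have e2 := hr a' (by simp)
      omega
  · cases as with
    | nil => simp at h1 h2; exact ⟨h1, h2.1.symm, h2.2.symm⟩
    | cons x as =>
      simp only [List.cons_append, List.cons.injEq] at h2
      obtain ⟨rfl, rfl⟩ := h2
      have e1 := hl a' (by simp [h1])
      have e2 := hr' a (by simp)
      omega

theorem Represents.unique {P : BinaryTree Unit} :
    ∀ {Q w}, Represents P w → Represents Q w → P = Q := by
  induction P with
  | nil =>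
    rintro (_ | ⟨u, L, R⟩) w rfl h
    · rfl
    · obtain ⟨l, a, r, h, -⟩ := h
      simp at h
  | node u L R hL hR =>
    rintro (_ | ⟨u', L', R'⟩) w ⟨l, a, r, rfl, h1, h2, h3, h4, -⟩ h
    · simp [Represents] at h
    · obtain ⟨l', a', r', h, h1', h2', h3', h4', -⟩ := h
      obtain ⟨rfl, rfl, rfl⟩ := append_cons_inj_of_max h h3 h4 h3' h4'
      rw [hL h1 h1', hR h2 h2']

/-- Two words represented by the same tree are order-isomorphic. -/
theorem Represents.exists_zip {P : BinaryTree Unit} :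
    ∀ {s t}, Represents P s → Represents P t → ∃ z : List (ℕ × ℕ),
      z.map Prod.fst = s ∧ z.map Prod.snd = t ∧ ∀ p ∈ z, ∀ q ∈ z, p.1 < q.1 ↔ p.2 < q.2 := by
  induction P with
  | nil => rintro s t rfl rfl; exact ⟨[], by simp⟩
  | node u L R hL hR =>
    rintro s t ⟨l, a, r, rfl, h1, h2, h3, h4, h5⟩ ⟨l', a', r', rfl, h1', h2', h3', h4', h5'⟩
    obtain ⟨z, rfl, rfl, hz⟩ := hL h1 h1'
    obtain ⟨y, rfl, rfl, hy⟩ := hR h2 h2'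
    refine ⟨z ++ (a, a') :: y, by simp, by simp, ?_⟩
    simp only [List.forall_mem_map] at h3 h4 h5 h3' h4' h5'
    intro p hp q hq
    simp only [List.mem_append, List.mem_cons] at hp hq
    rcases hp with hp | rfl | hp <;> rcases hq with hq | rfl | hq
    · exact hz p hp q hq
    · simp [h3 p hp, h3' p hp]
    · exact iff_of_false (h5 p hp q hq).not_gt (h5' p hp q hq).not_gt
    · exact iff_of_false (h3 q hq).not_gt (h3' q hq).not_gt
    · simp
    · exact iff_of_false (h4 q hq).not_gt (h4' q hq).not_gt
    · simp [h5 q hq p hp, h5' q hq p hp]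
    · simp [h4 p hp, h4' p hp]
    · exact hy p hp q hq

/-- A word order-isomorphic to a represented word is represented by the same tree. -/
theorem Represents.of_zip {P : BinaryTree Unit} : ∀ {z : List (ℕ × ℕ)},
    Represents P (z.map Prod.snd) → (∀ p ∈ z, ∀ q ∈ z, p.1 < q.1 ↔ p.2 < q.2) →
      Represents P (z.map Prod.fst) := by
  induction P with
  | nil => intro z h _; simpa [Represents] using h
  | node u L R hL hR =>
    rintro z ⟨l, a, r, h, h1, h2, h3, h4, h5⟩ hz
    obtain ⟨z₁, z₂, rfl, rfl, h'⟩ := List.map_eq_append_iff.mp h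
    obtain ⟨p, z₂, rfl, rfl, rfl⟩ := List.map_eq_cons_iff.mp h'
    simp only [List.forall_mem_map] at h3 h4 h5
    refine ⟨z₁.map Prod.fst, p.1, z₂.map Prod.fst, by simp,
      hL h1 fun p hp q hq => hz p (by simp [hp]) q (by simp [hq]),
      hR h2 fun p hp q hq => hz p (by simp [hp]) q (by simp [hq]), ?_, ?_, ?_⟩
    · simp only [List.forall_mem_map]
      exact fun q hq => (hz q (by simp [hq]) p (by simp)).mpr (h3 q hq)
    · simp only [List.forall_mem_map]
      exact fun q hq => (hz q (by simp [hq]) p (by simp)).mpr (h4 q hq)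
    · simp only [List.forall_mem_map]
      exact fun q hq q' hq' => (hz q' (by simp [hq']) q (by simp [hq])).mpr (h5 q hq q' hq')

/-- Together with the upper bound c this confines the labels to the interval (c - |T|, c]. Requiring
|T| ≤ c keeps the natural subtraction in the labelling from truncating. -/
theorem lt_add_of_mem_inorder_preorderLabel (T : BinaryTree Unit) :
    ∀ c x, T.numNodes ≤ c → x ∈ inorder (preorderLabel c T) → c < x + T.numNodes := by
  induction T with
  | nil => intro c x _ hx; simp [preorderLabel, inorder] at hx
  | node a l r hl hr =>
    intro c x hc hx
    simp only [preorderLabel, inorder, List.mem_append, List.mem_cons] at hx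
    simp only [BinaryTree.numNodes] at hc ⊢
    rcases hx with h | h | h
    · have := hl _ _ (by omega) h; omega
    · omega
    · have := hr _ _ (by omega) h; omega

/-- Pre-order visits the root, then all of the left subtree, then the right one, so decreasing
labels put the root above the left block and the left block above the right block. -/
theorem represents_inorder_preorderLabel (T : BinaryTree Unit) :
    ∀ c, T.numNodes ≤ c → Represents T (inorder (preorderLabel c T)) := by
  induction T with
  | nil => intro c _; rfl
  | node a l r hl hr =>
    intro c hc
    simp only [BinaryTree.numNodes] at hc
    refine ⟨_, _, _, rfl, hl _ (by omega), hr _ (by omega), ?_, ?_, ?_⟩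
    · intro x hx
      have := le_of_mem_inorder_preorderLabel _ _ _ hx
      omega
    · intro x hx
      have := le_of_mem_inorder_preorderLabel _ _ _ hx
      omega
    · intro x hx y hy
      have h1 := le_of_mem_inorder_preorderLabel _ _ _ hy
      have h2 := lt_add_of_mem_inorder_preorderLabel _ _ _ (by omega) hx
      omega

theorem represents_treeWord (T : BinaryTree Unit) : Represents T (treeWord T) :=
  represents_inorder_preorderLabel T _ le_rfl

/-! ### Trees induced on sets of vertices -/

/-- Attach `S` below the last vertex of the spine of the root of `Q`. -/
def graft : BinaryTree Unit → BinaryTree Unit → BinaryTree Unit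
  | .nil, S => S
  | .node u L R, S => .node u L (graft R S)

/-- The pairs `(Q, S)` with `graft Q S = P`. -/
def splits : BinaryTree Unit → List (BinaryTree Unit × BinaryTree Unit)
  | .nil => [(.nil, .nil)]
  | .node u L R => (.nil, .node u L R) :: (splits R).map fun p => (.node u L p.1, p.2)

/-- The pairs consisting of the left and the right subtree, if the tree is not empty. -/
def subtrees : BinaryTree Unit → List (BinaryTree Unit × BinaryTree Unit)
  | .nil => []
  | .node _ L R => [(L, R)]

/-- The trees induced on the sets of vertices of a tree, with multiplicity. -/
def induced : BinaryTree Unit → List (BinaryTree Unit)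
  | .nil => [.nil]
  | .node u l r => (induced r).flatMap fun y =>
      (induced l).map (graft · y) ++ (induced l).map (.node u · y)

/-- As t lies below s, the maximum of s ++ t is that of s, and t is appended to the part right of
it; iterating, t descends along right children to the end of the root spine of Q. -/
theorem Represents.graft {Q : BinaryTree Unit} : ∀ {S s t}, Represents Q s → Represents S t →
    (∀ x ∈ s, ∀ y ∈ t, y < x) → Represents (graft Q S) (s ++ t) := by
  induction Q with
  | nil => rintro S s t rfl h _; simpa [Pop132.graft] using h
  | node u L R hL hR =>
    rintro S s t ⟨l, a, r, rfl, h1, h2, h3, h4, h5⟩ h hst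
    refine ⟨l, a, r ++ t, by simp, h1, hR h2 h fun x hx => hst x (by simp [hx]), h3, ?_, ?_⟩
    · intro y hy
      rcases List.mem_append.mp hy with hy | hy
      · exact h4 y hy
      · exact hst a (by simp) y hy
    · intro x hx y hy
      rcases List.mem_append.mp hy with hy | hy
      · exact h5 x hx y hy
      · exact hst x (by simp [hx]) y hy

/-- `induced` is defined to run in the same order as `List.sublists`, so the two lists match entry
by entry, with multiplicity. The inclusion s ⊆ w is carried along so that subwords inherit the
inequalities between the blocks of w. -/
theorem forall₂_induced_sublists {T : BinaryTree Unit} : ∀ {w}, Represents T w →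
    List.Forall₂ (fun P s => Represents P s ∧ s ⊆ w) (induced T) w.sublists := by
  induction T with
  | nil => rintro w rfl; simp [induced, Represents]
  | node u L R hL hR =>
    rintro w ⟨l, a, r, rfl, h1, h2, h3, h4, h5⟩
    -- For each sublist y of r come the subwords omitting the maximum a, then those containing it.
    have key : (l ++ a :: r).sublists = r.sublists.flatMap fun y =>
        l.sublists.map (· ++ y) ++ l.sublists.map (· ++ a :: y) := by
      rw [List.sublists_append, List.sublists_cons]
      simp [List.flatMap_assoc]
    rw [key, induced]
    refine List.rel_flatMap (hR h2) ?_
    rintro S t ⟨hS, ht⟩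
    refine List.rel_append (List.rel_map ?_ (hL h1)) (List.rel_map ?_ (hL h1))
    · rintro Q s ⟨hQ, hs⟩
      refine ⟨hQ.graft hS fun x hx y hy => h5 x (hs hx) y (ht hy), ?_⟩
      intro x hx
      rcases List.mem_append.mp hx with hx | hx
      · simp [hs hx]
      · simp [ht hx]
    · rintro Q s ⟨hQ, hs⟩
      refine ⟨⟨s, a, t, rfl, hQ, hS, fun x hx => h3 x (hs hx), fun x hx => h4 x (ht hx),
        fun x hx y hy => h5 x (hs hx) y (ht hy)⟩, ?_⟩
      intro x hx
      simp only [List.mem_append, List.mem_cons] at hx ⊢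
      rcases hx with hx | rfl | hx
      · exact .inl (hs hx)
      · simp
      · exact .inr (.inr (ht hx))

open Classical in
theorem countP_represents_sublists {T P : BinaryTree Unit} {w : List ℕ} (h : Represents T w) :
    w.sublists.countP (fun s => Represents P s) = (induced T).count P := by
  have := forall₂_induced_sublists h
  generalize w.sublists = M at this
  generalize induced T = N at this
  induction this with
  | nil => simp
  | @cons Q s _ _ h _ ih =>
    rw [List.countP_cons, List.count_cons, ih]
    have : Represents P s ↔ Q = P := ⟨fun h' => h.1.unique h', fun e => e ▸ h.1⟩
    simp [this]

/-- Every subword of a represented word is represented by some tree. -/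
theorem Represents.exists_of_sublist {T : BinaryTree Unit} {w s : List ℕ} (h : Represents T w)
    (hs : s.Sublist w) : ∃ P, Represents P s := by
  obtain ⟨i, hi, rfl⟩ := List.mem_iff_getElem.mp (List.mem_sublists.mpr hs)
  have h2 := forall₂_induced_sublists h
  have hi' : i < (induced T).length := h2.length_eq ▸ hi
  exact ⟨_, (h2.get hi' hi).1⟩

/-- Each way of cutting the root spine is listed exactly once, so `splits P` is the fibre of `graft`
over P. -/
theorem count_splits (P Q S : BinaryTree Unit) :
    (splits P).count (Q, S) = if graft Q S = P then 1 else 0 := by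
  induction P generalizing Q with
  | nil =>
    cases Q with
    | nil => by_cases h : S = .nil <;> simp [splits, graft, h, List.count_eq_zero]
    | node => simp [splits, graft]
  | node u L R _ hR =>
    cases Q with
    | nil =>
      have : ((splits R).map fun p => (BinaryTree.node u L p.1, p.2)).count (.nil, S) = 0 := by
        rw [List.count_eq_zero]; simp
      rw [splits, List.count_cons, this]
      simp [graft, eq_comm (a := S)]
    | node u' L' R' =>
      rw [splits, List.count_cons]
      simp only [graft]
      by_cases hL : L' = L
      · subst hL
        have := List.count_map_of_injective (splits R)
          (fun p : BinaryTree Unit × BinaryTree Unit => (BinaryTree.node u L' p.1, p.2))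
          (by rintro ⟨a, b⟩ ⟨c, d⟩ h; simpa using h) (R', S)
        simp only at this
        rw [this, hR]
        simp
      · have : ((splits R).map fun p => (BinaryTree.node u L p.1, p.2)).count
            (.node u' L' R', S) = 0 := by
          rw [List.count_eq_zero]; simp [Ne.symm hL]
        rw [this]
        simp [hL]

theorem count_subtrees (u : Unit) (P Q S : BinaryTree Unit) :
    (subtrees P).count (Q, S) = if BinaryTree.node u Q S = P then 1 else 0 := by
  cases P with
  | nil => simp [subtrees]
  | node u' L R =>
    simp [subtrees, List.count_singleton, eq_comm (a := L), eq_comm (a := R)]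

/-- Counting the values of a binary operation on two lists through its fibre. -/
theorem count_flatMap_map {α β γ : Type*} [DecidableEq α] [DecidableEq β] [DecidableEq γ]
    (f : α → β → γ) (c : γ) (D : List (α × β))
    (hD : ∀ x y, D.count (x, y) = if f x y = c then 1 else 0) (l : List α) (r : List β) :
    (r.flatMap fun y => l.map (f · y)).count c =
      (D.map fun d => l.count d.1 * r.count d.2).sum := by
  have inner : ∀ y, (l.map (f · y)).count c =
      (D.map fun d => l.count d.1 * if y = d.2 then 1 else 0).sum := by
    intro y
    induction l with
    | nil => simp
    | cons x l ih =>
      -- The sum of the indicators is the multiplicity of (x, y) in D.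
      have hx : (D.map fun d => (if x = d.1 then 1 else 0) * if y = d.2 then 1 else 0).sum =
          if f x y = c then 1 else 0 := by
        rw [← hD]
        clear hD ih
        induction D with
        | nil => simp
        | cons d D ih =>
          rw [List.map_cons, List.sum_cons, ih, List.count_cons, add_comm]
          by_cases h1 : d.1 = x <;>
            simp [Prod.ext_iff, eq_comm (a := x), eq_comm (a := y), h1]
      simp only [List.map_cons, List.count_cons, ih, add_mul, List.sum_map_add, beq_iff_eq, ← hx]
  induction r with
  | nil => simp
  | cons y r ih =>
    simp only [List.flatMap_cons, List.count_append, ih, inner, List.count_cons, mul_add,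
      List.sum_map_add, beq_iff_eq]
    omega

/-- The first sum counts the vertex sets that omit the root, the second those that contain it. -/
theorem count_induced_node (u : Unit) (l r P : BinaryTree Unit) :
    (induced (.node u l r)).count P =
      ((splits P).map fun d => (induced l).count d.1 * (induced r).count d.2).sum +
      ((subtrees P).map fun d => (induced l).count d.1 * (induced r).count d.2).sum := by
  rw [← count_flatMap_map graft P _ (fun x y => count_splits P x y),
    ← count_flatMap_map (.node u) P _ (fun x y => count_subtrees u P x y), induced]
  simp only [List.count_flatMap, Function.comp_def, List.count_append, List.sum_map_add]

open PowerSeries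

/-! ### The generating function of the occurrences of a tree -/

/-- The generating function of the total number of occurrences of `P` in the trees with `n`
vertices. -/
noncomputable def occurrenceSeries (P : BinaryTree Unit) : ℕ⟦X⟧ :=
  .mk fun n => ∑ T ∈ BinaryTree.treesOfNumNodesEq n, (induced T).count P

theorem sum_treesOfNumNodesEq_succ (n : ℕ) (f : BinaryTree Unit → ℕ) :
    ∑ T ∈ BinaryTree.treesOfNumNodesEq (n + 1), f T =
      ∑ p ∈ Finset.HasAntidiagonal.antidiagonal n, ∑ l ∈ BinaryTree.treesOfNumNodesEq p.1,
        ∑ r ∈ BinaryTree.treesOfNumNodesEq p.2, f (.node () l r) := by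
  rw [BinaryTree.treesOfNumNodesEq_succ, Finset.sum_biUnion]
  · refine Finset.sum_congr rfl fun p _ => ?_
    rw [Finset.sum_map, Finset.sum_product]
    rfl
  · intro p _ q _ hpq
    refine Finset.disjoint_left.mpr fun T hp hq => hpq ?_
    simp only [Finset.mem_map, Finset.mem_product, BinaryTree.mem_treesOfNumNodesEq] at hp hq
    obtain ⟨⟨a, b⟩, ⟨h1, h2⟩, rfl⟩ := hp
    obtain ⟨⟨c, d⟩, ⟨h3, h4⟩, h⟩ := hq
    simp at h
    ext <;> simp_all

/-- The right-hand side of the recurrence for the generating functions. -/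
noncomputable def convolution (F : BinaryTree Unit → ℕ⟦X⟧) (P : BinaryTree Unit) : ℕ⟦X⟧ :=
  ((splits P).map fun d => F d.1 * F d.2).sum + ((subtrees P).map fun d => F d.1 * F d.2).sum

theorem coeff_list_sum {α : Type*} (n : ℕ) (D : List α) (f : α → ℕ⟦X⟧) :
    coeff n (D.map f).sum = (D.map fun d => coeff n (f d)).sum := by
  rw [map_list_sum, List.map_map]
  rfl

theorem coeff_zero_occurrenceSeries (P : BinaryTree Unit) :
    coeff 0 (occurrenceSeries P) = [BinaryTree.nil].count P := by
  simp [occurrenceSeries, induced]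

theorem coeff_succ_occurrenceSeries (n : ℕ) (P : BinaryTree Unit) :
    coeff (n + 1) (occurrenceSeries P) = coeff n (convolution occurrenceSeries P) := by
  have key : ∀ D : List (BinaryTree Unit × BinaryTree Unit),
      coeff n (D.map fun d => occurrenceSeries d.1 * occurrenceSeries d.2).sum =
      ∑ p ∈ Finset.HasAntidiagonal.antidiagonal n, ∑ l ∈ BinaryTree.treesOfNumNodesEq p.1,
        ∑ r ∈ BinaryTree.treesOfNumNodesEq p.2,
          (D.map fun d => (induced l).count d.1 * (induced r).count d.2).sum := by
    intro D
    rw [coeff_list_sum]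
    induction D with
    | nil => simp
    | cons d D ih =>
      rw [List.map_cons, List.sum_cons, ih]
      simp only [List.map_cons, List.sum_cons, Finset.sum_add_distrib, coeff_mul, occurrenceSeries,
        coeff_mk, Finset.sum_mul_sum]
  rw [convolution, map_add, key, key, occurrenceSeries, coeff_mk, sum_treesOfNumNodesEq_succ]
  simp only [count_induced_node, Finset.sum_add_distrib]

/-- The coefficient at n + 1 involves only coefficients of index at most n, though of many trees
including P itself; hence strong induction on n for all trees at once. -/
theorem eq_of_convolution {F G : BinaryTree Unit → ℕ⟦X⟧}
    (h0 : ∀ P, coeff 0 (F P) = coeff 0 (G P))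
    (hF : ∀ n P, coeff (n + 1) (F P) = coeff n (convolution F P))
    (hG : ∀ n P, coeff (n + 1) (G P) = coeff n (convolution G P)) (P : BinaryTree Unit) :
    F P = G P := by
  ext n
  induction n using Nat.strong_induction_on generalizing P with
  | _ n ih =>
    cases n with
    | zero => exact h0 P
    | succ n =>
      have key : ∀ Q S, coeff n (F Q * F S) = coeff n (G Q * G S) := by
        intro Q S
        rw [coeff_mul, coeff_mul]
        refine Finset.sum_congr rfl fun p hp => ?_
        have := Finset.HasAntidiagonal.mem_antidiagonal.mp hp
        rw [ih p.1 (by omega), ih p.2 (by omega)]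
      simp only [hF, hG, convolution, map_add, coeff_list_sum, key]

/-! ### The contribution of a spine -/

/-- The coefficients of the solution `B` of `B = 1 + X * u * B`. -/
noncomputable def geomCoeff (u : ℕ⟦X⟧) : ℕ → ℕ
  | 0 => 1
  | n + 1 => ∑ i : Fin (n + 1), geomCoeff u i * coeff (n - i) u

/-- The geometric series of `X * u`. -/
noncomputable def geomSeries (u : ℕ⟦X⟧) : ℕ⟦X⟧ := .mk (geomCoeff u)

theorem geomSeries_eq (u : ℕ⟦X⟧) : geomSeries u = 1 + X * (geomSeries u * u) := by
  ext n
  cases n with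
  | zero => simp [geomSeries, geomCoeff]
  | succ n =>
    rw [map_add, coeff_succ_X_mul, coeff_mul,
      Finset.Nat.sum_antidiagonal_eq_sum_range_succ
        (fun i j => coeff i (geomSeries u) * coeff j u), Finset.sum_range]
    simp [geomSeries, geomCoeff, coeff_one]

/-- The factor that a spine with `m` vertices contributes to the generating function. -/
noncomputable def spineSeries : ℕ → ℕ⟦X⟧
  | 0 => 1
  | m + 1 => X * catalanSeries * geomSeries (2 * catalanSeries) *
      (∑ i : Fin m, spineSeries (i + 1) * spineSeries (m - i) + spineSeries m)
decreasing_by all_goals omega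

theorem spineSeries_zero : spineSeries 0 = 1 := by rw [spineSeries]

theorem spineSeries_succ (m : ℕ) : spineSeries (m + 1) =
    X * catalanSeries * geomSeries (2 * catalanSeries) *
      (∑ i ∈ Finset.range m, spineSeries (i + 1) * spineSeries (m - i) + spineSeries m) := by
  rw [spineSeries, Finset.sum_range]

/-- This is the recurrence that the trees produce. Its terms (0, m + 1) and (m + 1, 0) contain the
unknown itself; solving for it gives the factor 1/(1 - 2XC), which over ℕ is `geomSeries (2 *
catalanSeries)` and explains the definition of `spineSeries`. -/
theorem spineSeries_succ_eq_antidiagonal (m : ℕ) : spineSeries (m + 1) =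
    X * catalanSeries * (∑ p ∈ Finset.HasAntidiagonal.antidiagonal (m + 1), spineSeries p.1 * spineSeries p.2 +
      spineSeries m) := by
  rw [Finset.Nat.sum_antidiagonal_eq_sum_range_succ (fun i j => spineSeries i * spineSeries j),
    Finset.sum_range_succ, Finset.sum_range_succ']
  simp only [Nat.add_sub_add_right, Nat.sub_zero, Nat.sub_self, spineSeries_zero]
  rw [spineSeries_succ m]
  generalize ∑ i ∈ Finset.range m, spineSeries (i + 1) * spineSeries (m - i) = Z
  -- Unrolling the geometric series once, on the left only, yields the two end terms.
  nth_rewrite 1 [geomSeries_eq]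
  ring

/-- Coefficientwise comparison of power series. -/
def CoeffLE (f g : ℕ⟦X⟧) : Prop := ∀ n, coeff n f ≤ coeff n g

theorem CoeffLE.refl (f : ℕ⟦X⟧) : CoeffLE f f := fun _ => le_rfl

theorem CoeffLE.trans {f g h : ℕ⟦X⟧} (h1 : CoeffLE f g) (h2 : CoeffLE g h) : CoeffLE f h :=
  fun n => (h1 n).trans (h2 n)

theorem CoeffLE.add {f g f' g' : ℕ⟦X⟧} (h : CoeffLE f g) (h' : CoeffLE f' g') :
    CoeffLE (f + f') (g + g') := fun n => by
  simpa using add_le_add (h n) (h' n)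

theorem CoeffLE.mul {f g f' g' : ℕ⟦X⟧} (h : CoeffLE f g) (h' : CoeffLE f' g') :
    CoeffLE (f * f') (g * g') := fun n => by
  rw [coeff_mul, coeff_mul]
  exact Finset.sum_le_sum fun p _ => Nat.mul_le_mul (h _) (h' _)

theorem CoeffLE.sum {ι : Type*} {s : Finset ι} {f g : ι → ℕ⟦X⟧} (h : ∀ i ∈ s, CoeffLE (f i) (g i)) :
    CoeffLE (∑ i ∈ s, f i) (∑ i ∈ s, g i) := fun n => by
  rw [map_sum, map_sum]
  exact Finset.sum_le_sum fun i hi => h i hi n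

theorem CoeffLE.sum_subset {ι : Type*} {s t : Finset ι} {f : ι → ℕ⟦X⟧} (h : s ⊆ t) :
    CoeffLE (∑ i ∈ s, f i) (∑ i ∈ t, f i) := fun n => by
  rw [map_sum, map_sum]
  exact Finset.sum_le_sum_of_subset h

/-- Merging two spines does not decrease the contribution. -/
theorem spineSeries_mul_le (a b : ℕ) :
    CoeffLE (spineSeries a * spineSeries b) (spineSeries (a + b)) := by
  induction a using Nat.strong_induction_on with
  | _ a ih =>
    cases a with
    | zero => rw [spineSeries_zero, one_mul, zero_add]; exact .refl _
    | succ a =>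
      rw [spineSeries_succ, show a + 1 + b = a + b + 1 by omega, spineSeries_succ, mul_assoc]
      refine (CoeffLE.refl _).mul ?_
      rw [add_mul, Finset.sum_mul]
      -- After the common factor is removed, the induction hypothesis absorbs s_b into the second
      -- factor s_{a-i}. This gives the first a terms of the sum for a + b; the remaining terms are
      -- only a gain.
      refine .add (.trans (.sum (g := fun i => spineSeries (i + 1) * spineSeries (a + b - i)) ?_)
        (.sum_subset (Finset.range_mono (Nat.le_add_right a b)))) (ih a (by omega))
      intro i hi
      have hi := Finset.mem_range.mp hi
      rw [mul_assoc, show a + b - i = a - i + b by omega]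
      exact (CoeffLE.refl _).mul (ih _ (by omega))

theorem prod_spineSeries_le (l : List ℕ) :
    CoeffLE (l.map spineSeries).prod (spineSeries l.sum) := by
  induction l with
  | nil => simpa [spineSeries_zero] using CoeffLE.refl _
  | cons a l ih =>
    rw [List.map_cons, List.prod_cons, List.sum_cons]
    exact ((CoeffLE.refl _).mul ih).trans (spineSeries_mul_le _ _)

theorem RefinementLE.prod_spineSeries_le {b a : List ℕ} (h : RefinementLE b a) :
    CoeffLE (b.map spineSeries).prod (a.map spineSeries).prod := by
  obtain ⟨P, -, hb, ha⟩ := h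
  rw [← (hb.map _).prod_eq, ← (ha.map _).prod_eq]
  clear hb ha
  induction P with
  | nil => simpa using CoeffLE.refl _
  | cons l P ih =>
    simp only [List.flatten_cons, List.map_append, List.prod_append, List.map_cons,
      List.prod_cons]
    exact (Pop132.prod_spineSeries_le l).mul ih

/-! ### The generating function as a product over the spines -/

/-- The number of vertices of the spine of the root. -/
def rootSpine : BinaryTree Unit → ℕ
  | .nil => 0
  | .node _ _ R => rootSpine R + 1

/-- The product of the contributions of the spines that do not contain the root. -/
noncomputable def lowerProd : BinaryTree Unit → ℕ⟦X⟧
  | .nil => 1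
  | .node _ L R => lowerProd L * spineSeries (rootSpine L) * lowerProd R

/-- Cutting the root spine distributes the other spines over the two pieces, so the product of their
`lowerProd`s is always `lowerProd P`, and each pair of lengths adding up to the root spine occurs
once. The function h is arbitrary so that the induction can shift its first argument. -/
theorem sum_splits (P : BinaryTree Unit) (h : ℕ → ℕ → ℕ⟦X⟧) :
    ((splits P).map fun d => lowerProd d.1 * lowerProd d.2 *
      h (rootSpine d.1) (rootSpine d.2)).sum =
      lowerProd P * ∑ p ∈ Finset.HasAntidiagonal.antidiagonal (rootSpine P), h p.1 p.2 := by
  induction P generalizing h with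
  | nil => simp [splits, lowerProd, rootSpine]
  | node u L R _ hR =>
    have := hR fun i j => h (i + 1) j
    rw [splits, List.map_cons, List.sum_cons, List.map_map,
      show rootSpine (.node u L R) = rootSpine R + 1 from rfl, Finset.Nat.sum_antidiagonal_succ, mul_add]
    congr 1
    · simp [lowerProd, rootSpine]
    · simp only [lowerProd, mul_assoc, ← this, ← List.sum_map_mul_left, Function.comp_def,
        rootSpine]

theorem occurrenceSeries_eq (P : BinaryTree Unit) :
    occurrenceSeries P = catalanSeries * (lowerProd P * spineSeries (rootSpine P)) := by
  -- The product satisfies the recurrence of `occurrenceSeries`: the empty tree needs C = 1 + X C²,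
  -- and any other tree reduces to the recurrence of `spineSeries` times C and `lowerProd P`.
  have hrec : ∀ P, catalanSeries * (lowerProd P * spineSeries (rootSpine P)) =
      (if P = .nil then 1 else 0) + X * convolution
        (fun P => catalanSeries * (lowerProd P * spineSeries (rootSpine P))) P := by
    intro P
    have hs := sum_splits P fun i j => catalanSeries ^ 2 * (spineSeries i * spineSeries j)
    rw [convolution]
    have e : ∀ d : BinaryTree Unit × BinaryTree Unit,
        catalanSeries * (lowerProd d.1 * spineSeries (rootSpine d.1)) *
        (catalanSeries * (lowerProd d.2 * spineSeries (rootSpine d.2))) =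
        lowerProd d.1 * lowerProd d.2 *
        (catalanSeries ^ 2 * (spineSeries (rootSpine d.1) * spineSeries (rootSpine d.2))) :=
      fun d => by ring
    simp only [e, hs, ← Finset.mul_sum]
    cases P with
    | nil =>
      simp only [lowerProd, rootSpine, spineSeries_zero, subtrees]
      nth_rewrite 1 [← catalanSeries_sq_mul_X_add_one]
      simp [spineSeries_zero]
      ring
    | node u L R =>
      simp only [rootSpine, subtrees, lowerProd, List.map_cons, List.map_nil, List.sum_cons,
        List.sum_nil]
      rw [spineSeries_succ_eq_antidiagonal]
      simp
      ring
  refine eq_of_convolution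
    (G := fun P => catalanSeries * (lowerProd P * spineSeries (rootSpine P))) ?_ coeff_succ_occurrenceSeries ?_ P
  · intro P
    rw [coeff_zero_occurrenceSeries, hrec P]
    by_cases h : P = .nil
    · simp [h]
    · simp [h, List.count_eq_zero]
  · intro n P
    rw [hrec P, map_add, coeff_succ_X_mul]
    split_ifs <;> simp [coeff_one]

theorem prod_spines (P : BinaryTree Unit) :
    lowerProd P * spineSeries (rootSpine P) =
      (((spines P).map List.length).map spineSeries).prod := by
  -- The root spine must be kept apart as the head of the list, since adding a root lengthens the
  -- head from the right subtree and leaves all other spines unchanged.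
  suffices h : (P = .nil ∧ spines P = []) ∨ ∃ s ss, spines P = s :: ss ∧
      s.length = rootSpine P ∧ lowerProd P = ((ss.map List.length).map spineSeries).prod by
    rcases h with ⟨rfl, h⟩ | ⟨s, ss, h1, h2, h3⟩
    · simp [h, lowerProd, rootSpine, spineSeries_zero]
    · simp [h1, h2, h3, mul_comm]
  induction P with
  | nil => simp [spines]
  | node u L R hL hR =>
    have hL' : lowerProd L * spineSeries (rootSpine L) =
        (((spines L).map List.length).map spineSeries).prod := by
      rcases hL with ⟨rfl, h⟩ | ⟨s, ss, h1, h2, h3⟩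
      · simp [h, lowerProd, rootSpine, spineSeries_zero]
      · simp [h1, h2, h3, mul_comm]
    right
    rcases hR with ⟨rfl, h⟩ | ⟨s, ss, h1, h2, h3⟩
    · exact ⟨[u], spines L, by simp [spines], by simp [rootSpine], by simp [lowerProd, hL']⟩
    · refine ⟨u :: s, spines L ++ ss, by simp [spines, h1], by simp [rootSpine, h2], ?_⟩
      rw [lowerProd, hL', h3]
      simp

theorem occurrenceSeries_eq_prod (P : BinaryTree Unit) :
    occurrenceSeries P = catalanSeries * ((spineStructure P).map spineSeries).prod := by
  rw [occurrenceSeries_eq, prod_spines, spineStructure]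
  congr 1
  exact ((List.perm_insertionSort _ _).map _).prod_eq.symm

/-! ### From permutations to trees -/

theorem oneLine_injective {n : ℕ} : Function.Injective (oneLine (n := n)) := by
  intro σ ρ h
  ext i
  have := congrFun (List.ofFn_injective h) i
  simpa using this

theorem represents_oneLine {n : ℕ} (σ : Equiv.Perm (Fin n)) (hσ : Avoids132 σ) :
    Represents (tree σ hσ) (oneLine σ) :=
  treeWord_tree σ hσ ▸ represents_treeWord _

theorem numNodes_tree {n : ℕ} (σ : Equiv.Perm (Fin n)) (hσ : Avoids132 σ) :
    (tree σ hσ).numNodes = n := by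
  rw [← (represents_oneLine σ hσ).length_eq, oneLine, List.length_ofFn]

/-- The subword of `σ` at the positions `e`. -/
def subword {n k : ℕ} (σ : Equiv.Perm (Fin n)) (e : Fin k ↪o Fin n) : List ℕ :=
  List.ofFn fun i => (σ (e i) : ℕ) + 1

theorem subword_sublist {n k : ℕ} (σ : Equiv.Perm (Fin n)) (e : Fin k ↪o Fin n) :
    (subword σ e).Sublist (oneLine σ) := by
  refine List.sublist_iff_exists_fin_orderEmbedding_get_eq.mpr
    ⟨((Fin.castOrderIso (by simp [subword])).toOrderEmbedding.trans e).trans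
      (Fin.castOrderIso (by simp [oneLine])).toOrderEmbedding, fun i => ?_⟩
  simp only [List.get_eq_getElem]
  simp only [subword, oneLine, List.getElem_ofFn]
  rfl

theorem subword_injective {n k : ℕ} (σ : Equiv.Perm (Fin n)) :
    Function.Injective (subword (k := k) σ) := by
  intro e f h
  ext i
  have := congrFun (List.ofFn_injective h) i
  simp only [Nat.add_right_cancel_iff, Fin.val_inj, EmbeddingLike.apply_eq_iff_eq] at this
  rw [this]

theorem exists_subword_eq {n : ℕ} (σ : Equiv.Perm (Fin n)) {s : List ℕ}
    (hs : s.Sublist (oneLine σ)) {k : ℕ} (hk : s.length = k) :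
    ∃ e : Fin k ↪o Fin n, subword σ e = s := by
  subst hk
  obtain ⟨f, hf⟩ := List.sublist_iff_exists_fin_orderEmbedding_get_eq.mp hs
  refine ⟨f.trans (Fin.castOrderIso (by simp [oneLine])).toOrderEmbedding, ?_⟩
  refine List.ext_get (by simp [subword]) fun i h1 h2 => ?_
  have := hf ⟨i, h2⟩
  rw [this]
  simp only [subword, oneLine, List.get_eq_getElem, List.getElem_ofFn]
  rfl

/-- The positions `e` carry the pattern `τ` exactly if the tree of `τ` represents the subword. -/
theorem represents_subword_iff {n k : ℕ} (σ : Equiv.Perm (Fin n)) (τ : Equiv.Perm (Fin k))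
    (hτ : Avoids132 τ) (e : Fin k ↪o Fin n) :
    Represents (tree τ hτ) (subword σ e) ↔ ∀ i j : Fin k, σ (e i) < σ (e j) ↔ τ i < τ j := by
  have hfst : (List.ofFn fun i => ((σ (e i) : ℕ) + 1, (τ i : ℕ) + 1)).map Prod.fst =
      subword σ e := by simp [subword, List.map_ofFn, Function.comp_def]
  have hsnd : (List.ofFn fun i => ((σ (e i) : ℕ) + 1, (τ i : ℕ) + 1)).map Prod.snd =
      oneLine τ := by simp [oneLine, List.map_ofFn, Function.comp_def]
  constructor
  · intro h i j
    obtain ⟨z, h1, h2, hz⟩ := h.exists_zip (represents_oneLine τ hτ)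
    -- A list of pairs is determined by its two projections.
    have hzeq : z = List.ofFn fun i => ((σ (e i) : ℕ) + 1, (τ i : ℕ) + 1) := by
      rw [← List.zip_unzip z, ← List.zip_unzip (List.ofFn _), List.unzip_eq_map,
        List.unzip_eq_map, h1, h2, hfst, hsnd]
    subst hzeq
    simpa using hz _ (List.mem_ofFn.mpr ⟨i, rfl⟩) _ (List.mem_ofFn.mpr ⟨j, rfl⟩)
  · intro h
    rw [← hfst]
    refine Represents.of_zip (hsnd ▸ represents_oneLine τ hτ) ?_
    intro p hp q hq
    obtain ⟨i, rfl⟩ := List.mem_ofFn.mp hp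
    obtain ⟨j, rfl⟩ := List.mem_ofFn.mp hq
    simpa using h i j

/-- Occurrences correspond bijectively to the subwords represented by the tree of τ; since the word
of σ has distinct entries, its list of subwords has no repetitions and counting in it is a
cardinality. -/
theorem numCopies_eq_count {n k : ℕ} (σ : Equiv.Perm (Fin n)) (hσ : Avoids132 σ)
    (τ : Equiv.Perm (Fin k)) (hτ : Avoids132 τ) :
    numCopies σ τ = (induced (tree σ hσ)).count (tree τ hτ) := by
  classical
  have hw := represents_oneLine σ hσ
  rw [← countP_represents_sublists hw, List.countP_eq_length_filter,
    ← List.toFinset_card_of_nodup ((List.nodup_sublists.mpr hw.nodup).filter _), numCopies,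
    ← Nat.card_eq_finsetCard]
  refine Nat.card_congr (Equiv.ofBijective (fun o => ⟨subword σ o.1, ?_⟩) ⟨?_, ?_⟩)
  · simpa using ⟨subword_sublist σ o.1, (represents_subword_iff σ τ hτ o.1).mpr o.2⟩
  · intro o o' h
    exact Subtype.ext (subword_injective σ (Subtype.ext_iff.mp h))
  · rintro ⟨s, hs⟩
    obtain ⟨h1, h2⟩ : s.Sublist (oneLine σ) ∧ Represents (tree τ hτ) s := by simpa using hs
    obtain ⟨e, rfl⟩ := exists_subword_eq σ h1 (h2.length_eq.trans (numNodes_tree τ hτ))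
    exact ⟨⟨e, (represents_subword_iff σ τ hτ e).mp h2⟩, rfl⟩

/-- Every binary tree is the tree of a `132`-avoiding permutation. -/
theorem exists_perm_tree_eq (T : BinaryTree Unit) {n : ℕ} (hT : T.numNodes = n) :
    ∃ (σ : Equiv.Perm (Fin n)) (hσ : Avoids132 σ), tree σ hσ = T := by
  subst hT
  have hw := represents_treeWord T
  have hlen : (treeWord T).length = T.numNodes := hw.length_eq
  have hmem : ∀ x ∈ treeWord T, 0 < x ∧ x ≤ T.numNodes := fun x hx =>
    ⟨by have := lt_add_of_mem_inorder_preorderLabel T _ x le_rfl hx; omega,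
      le_of_mem_inorder_preorderLabel T _ x hx⟩
  let f : Fin T.numNodes → Fin T.numNodes := fun i =>
    ⟨(treeWord T)[i] - 1, by
      have := hmem (treeWord T)[i] (List.getElem_mem _)
      omega⟩
  have hf : ∀ i, (f i : ℕ) + 1 = (treeWord T)[i] := fun i => by
    have := hmem (treeWord T)[i] (List.getElem_mem _)
    simp only [f]
    omega
  have hinj : Function.Injective f := by
    intro i j h
    have h' : (treeWord T)[i] = (treeWord T)[j] := by rw [← hf, ← hf, h]
    exact Fin.ext ((hw.nodup.getElem_inj_iff).mp h')
  let σ : Equiv.Perm (Fin T.numNodes) := Equiv.ofBijective f (Finite.injective_iff_bijective.mp hinj)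
  have hσT : oneLine σ = treeWord T := by
    refine List.ext_getElem (by simp [oneLine, hlen]) fun i h1 h2 => ?_
    simpa [oneLine, σ] using hf ⟨i, by omega⟩
  have hσ : Avoids132 σ := by
    refine ⟨fun ⟨e, he⟩ => ?_⟩
    obtain ⟨P, hP⟩ := hw.exists_of_sublist (hσT ▸ subword_sublist σ e)
    have h1 : σ (e 0) < σ (e 2) := (he 0 2).mpr (by decide)
    have h2 : σ (e 2) < σ (e 1) := (he 2 1).mpr (by decide)
    rw [Fin.lt_def] at h1 h2
    simp only [subword, List.ofFn_succ, List.ofFn_zero] at hP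
    -- In a three-letter word a, b, c with a < c < b, no letter can be the root: the first and the
    -- last are not maximal, and the middle one would require c < a.
    cases P with
    | nil => simp [Represents] at hP
    | node u L R =>
      obtain ⟨l, a, r, h, -, -, h3, h4, h5⟩ := hP
      rcases l with _ | ⟨x, _ | ⟨y, _ | ⟨z, l⟩⟩⟩
      · simp at h
        obtain ⟨rfl, rfl⟩ := h
        simp at h4
        omega
      · simp at h
        obtain ⟨rfl, rfl, rfl⟩ := h
        simp at h5
        omega
      · simp at h
        obtain ⟨rfl, rfl, rfl, rfl⟩ := h
        simp at h3
        omega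
      · simp at h
  exact ⟨σ, hσ, (existsUnique_tree σ hσ).unique (treeWord_tree σ hσ) hσT.symm⟩

/-- The map σ ↦ T(σ) is a bijection from S_n(132) to the binary trees with n vertices, so the sum
can be taken over trees. -/
theorem sum_numCopies_eq_coeff (n : ℕ) {k : ℕ} (τ : Equiv.Perm (Fin k)) (hτ : Avoids132 τ) :
    ∑ σ ∈ S132 n, numCopies σ τ = PowerSeries.coeff n (occurrenceSeries (tree τ hτ)) := by
  classical
  have hmem : ∀ σ : Equiv.Perm (Fin n), σ ∈ S132 n ↔ Avoids132 σ := fun σ => by simp [S132]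
  rw [occurrenceSeries, PowerSeries.coeff_mk]
  refine Finset.sum_bij (fun σ h => tree σ ((hmem σ).mp h)) ?_ ?_ ?_ ?_
  · intro σ h
    exact BinaryTree.mem_treesOfNumNodesEq.mpr (numNodes_tree σ _)
  · intro σ hσ ρ hρ h
    refine oneLine_injective ?_
    rw [← treeWord_tree σ ((hmem σ).mp hσ), ← treeWord_tree ρ ((hmem ρ).mp hρ), h]
  · intro T hT
    obtain ⟨σ, hσ, rfl⟩ := exists_perm_tree_eq T (BinaryTree.mem_treesOfNumNodesEq.mp hT)
    exact ⟨σ, (hmem σ).mpr hσ, rfl⟩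
  · intro σ h
    exact numCopies_eq_count σ _ τ hτ

end Pop132

theorem mainTheorem1 (k : ℕ) (τ μ : Equiv.Perm (Fin k))
    (hτ : Pop132.Avoids132 τ) (hμ : Pop132.Avoids132 μ)
    (h : Pop132.RefinementLE (Pop132.spineStructure (Pop132.tree τ hτ))
      (Pop132.spineStructure (Pop132.tree μ hμ))) (n : ℕ) :
    Pop132.popularity n τ ≤ Pop132.popularity n μ := by
  unfold Pop132.popularity
  split_ifs with hk
  · exact le_rfl
  · rw [Pop132.sum_numCopies_eq_coeff n τ hτ, Pop132.sum_numCopies_eq_coeff n μ hμ,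
      Pop132.occurrenceSeries_eq_prod, Pop132.occurrenceSeries_eq_prod]
    exact (Pop132.CoeffLE.refl _).mul h.prod_spineSeries_le n
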